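/- Let $n_x,n_y,K\ge 0$ be integers, $\varepsilon_0>0$, $\beta>0$, and let $f:\mathbb R^{n_x}\times\mathbb R^{n_y}\to\mathbb R^{n_x}$, $g:\mathbb R^{n_x}\times\mathbb R^{n_y}\to\mathbb R^{n_y}$ satisfy: $f\in C^{m}$ with $m=\max(K,1)$, and $f$ and all its derivatives up to order $m$ are bounded; $g\in C^{K+1}$, and all derivatives of $g$ of orders $1,\dots,K+1$ are bounded; and $$\langle y_1-y_2,\;g(x,y_1)-g(x,y_2)\rangle\le-\beta|y_1-y_2|^2\qquad\text{for all }x\in\mathbb R^{n_x},\ y_1,y_2\in\mathbb R^{n_y}.$$ For $\varepsilon\in(0,\varepsilon_0]$ consider the slow-fast system $$\dot x=f(x,y),\qquad \dot y=\tfrac1\varepsilon\,g(x,y),$$ and define maps $\Gamma_j(\cdot,\varepsilon):\mathbb R^{n_x}\to\mathbb R^{n_y}$ recursively by $$g(x,\Gamma_0(x,\varepsilon))=0,\qquad g(x,\Gamma_{j+1}(x,\varepsilon))=\varepsilon\,\nabla_x\Gamma_j(x,\varepsilon)\,f(x,\Gamma_j(x,\varepsilon)).$$ Let $0\le k\le K$.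 Then: (i) For every $\varepsilon\in(0,\varepsilon_0]$ the maps $\Gamma_0(\cdot,\varepsilon),\dots,\Gamma_k(\cdot,\varepsilon)$ are well defined (each defining equation has exactly one solution) and continuously differentiable. (ii) There is a constant $C_k>0$, depending on neither $\varepsilon$, the time, nor the solutions considered, such that for every $\varepsilon\in(0,\varepsilon_0]$, every $T\ge 0$, every solution $(x,y)$ of the slow-fast system on $[0,T]$ and every solution $X_k$ of $\dot X=f(X,\Gamma_k(X,\varepsilon))$ on $[0,T]$, with $z_k(0)=y(0)-\Gamma_k(x(0),\varepsilon)$, one has for all $t\in[0,T]$ $$|x(t)-X_k(t)|^2\le e^{C_kt}|x(0)-X_k(0)|^2+\varepsilon^{2k+2}\left(e^{C_kt}-1\right)+C_k\,\frac{e^{C_kt}-e^{-\frac{\beta}{\varepsilon}t}}{\frac{\beta}{\varepsilon}+C_k}\,|z_k(0)|^2,$$ where the last term is at most $\frac{C_k}{\beta}e^{C_kt}\,\varepsilon\,|z_k(0)|^2$. (iii) Consequently the reduced dynamics on $\Gamma_k$ is accurate to order $\varepsilon^{k+1}$ over finite times: for every $T>0$ and $R\ge0$ there is $M>0$ such that for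 every $\varepsilon\in(0,\varepsilon_0]$ and all solutions as in (ii) on $[0,T]$ with $|x(0)-X_k(0)|\le R\varepsilon^{k+1}$ and $|z_k(0)|^2\le R\varepsilon^{2k+1}$ (in particular when $X_k(0)=x(0)$ and $y(0)=\Gamma_k(x(0),\varepsilon)$), one has $|x(t)-X_k(t)|\le M\varepsilon^{k+1}$ for all $t\in[0,T]$. -/

import Mathlib

open Set

/-- `F` is of class `C^m` and its derivatives of all orders `j` with `l ≤ j ≤ m` are bounded.
With `l = 0` this is `F ∈ C^m ∩ W^{m,∞}`; with `l = 1` it is `F ∈ C^m`, `∇F ∈ W^{m-1,∞}`. -/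
structure HasBoundedDerivs {V W : Type*} [NormedAddCommGroup V] [NormedSpace ℝ V]
    [NormedAddCommGroup W] [NormedSpace ℝ W] (l m : ℕ) (F : V → W) : Prop where
  contDiff : ContDiff ℝ m F
  bounded : ∃ B : ℝ, ∀ j : ℕ, l ≤ j → j ≤ m → ∀ p : V, ‖iteratedFDeriv ℝ j F p‖ ≤ B

/-- Standing assumptions on the slow-fast system `x' = f (x, y)`, `y' = ε⁻¹ g (x, y)`:
`f` is bounded and smooth with bounded derivatives, `∇g` is smooth and bounded with bounded
derivatives, and `g` is strongly dissipative in the fast variable `y` with constant `β > 0`. -/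
structure SlowFastAssumptions {nx ny : ℕ}
    (f : EuclideanSpace ℝ (Fin nx) × EuclideanSpace ℝ (Fin ny) → EuclideanSpace ℝ (Fin nx))
    (g : EuclideanSpace ℝ (Fin nx) × EuclideanSpace ℝ (Fin ny) → EuclideanSpace ℝ (Fin ny))
    (β : ℝ) (K : ℕ) : Prop where
  regular_f : HasBoundedDerivs 0 (max K 1) f
  regular_g : HasBoundedDerivs 1 (K + 1) g
  beta_pos : 0 < β
  dissipative : ∀ (x : EuclideanSpace ℝ (Fin nx)) (y₁ y₂ : EuclideanSpace ℝ (Fin ny)),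
    inner ℝ (y₁ - y₂) (g (x, y₁) - g (x, y₂)) ≤ -β * ‖y₁ - y₂‖ ^ 2

/-- The solution `y` of the equation `g (x, y) = z`
(an arbitrary point if there is no solution). -/
noncomputable def fastSolve {nx ny : ℕ}
    (g : EuclideanSpace ℝ (Fin nx) × EuclideanSpace ℝ (Fin ny) → EuclideanSpace ℝ (Fin ny))
    (x : EuclideanSpace ℝ (Fin nx)) (z : EuclideanSpace ℝ (Fin ny)) :
    EuclideanSpace ℝ (Fin ny) :=
  Classical.epsilon fun y => g (x, y) = z

/-- The right-hand side `ε ∇Γ(x) f(x, Γ(x))`. -/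
noncomputable def iterRhs {nx ny : ℕ}
    (f : EuclideanSpace ℝ (Fin nx) × EuclideanSpace ℝ (Fin ny) → EuclideanSpace ℝ (Fin nx))
    (ε : ℝ) (Γ : EuclideanSpace ℝ (Fin nx) → EuclideanSpace ℝ (Fin ny))
    (x : EuclideanSpace ℝ (Fin nx)) : EuclideanSpace ℝ (Fin ny) :=
  ε • fderiv ℝ Γ x (f (x, Γ x))

/-- The iterates `Γ_k(·, ε)`: `g(x, Γ_0(x)) = 0` and
`g(x, Γ_{k+1}(x, ε)) = ε ∇_x Γ_k(x, ε) f(x, Γ_k(x, ε))`. -/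
noncomputable def slowIterate {nx ny : ℕ}
    (f : EuclideanSpace ℝ (Fin nx) × EuclideanSpace ℝ (Fin ny) → EuclideanSpace ℝ (Fin nx))
    (g : EuclideanSpace ℝ (Fin nx) × EuclideanSpace ℝ (Fin ny) → EuclideanSpace ℝ (Fin ny))
    (ε : ℝ) : ℕ → EuclideanSpace ℝ (Fin nx) → EuclideanSpace ℝ (Fin ny)
  | 0 => fun x => fastSolve g x 0
  | k + 1 => fun x => fastSolve g x (iterRhs f ε (slowIterate f g ε k) x)

/-- `(x, y)` solves `x' = f (x, y)`, `y' = ε⁻¹ g (x, y)` on `[0, T]`. -/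
def IsFullSolution {nx ny : ℕ}
    (f : EuclideanSpace ℝ (Fin nx) × EuclideanSpace ℝ (Fin ny) → EuclideanSpace ℝ (Fin nx))
    (g : EuclideanSpace ℝ (Fin nx) × EuclideanSpace ℝ (Fin ny) → EuclideanSpace ℝ (Fin ny))
    (ε T : ℝ) (x : ℝ → EuclideanSpace ℝ (Fin nx)) (y : ℝ → EuclideanSpace ℝ (Fin ny)) : Prop :=
  ∀ t ∈ Icc 0 T, HasDerivWithinAt x (f (x t, y t)) (Icc 0 T) t ∧
    HasDerivWithinAt y (ε⁻¹ • g (x t, y t)) (Icc 0 T) t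

/-- `X` solves the reduced equation `X' = f (X, Γ(X))` on `[0, T]`. -/
def IsReducedSolution {nx ny : ℕ}
    (f : EuclideanSpace ℝ (Fin nx) × EuclideanSpace ℝ (Fin ny) → EuclideanSpace ℝ (Fin nx))
    (Γ : EuclideanSpace ℝ (Fin nx) → EuclideanSpace ℝ (Fin ny))
    (T : ℝ) (X : ℝ → EuclideanSpace ℝ (Fin nx)) : Prop :=
  ∀ t ∈ Icc 0 T, HasDerivWithinAt X (f (X t, Γ (X t))) (Icc 0 T) t

/-! The fast error is `z = y - Γ_k(x)`. Its derivative splits into a dissipative term of rate `β/ε`,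
the defect `ε⁻¹ (g(x, Γ_k) - ε DΓ_k f(x, Γ_k))`, and a term bounded by a constant times `|z|`. If
the defect before division by `ε` is `O(ε^(k+1))` uniformly in `x` and `ε`, two energy inequalities
for `|x - X|²` and `|z|²` close up under a Gronwall comparison (`coupled_gronwall`).

The defect is the difference of the right-hand sides defining `Γ_k` and `Γ_{k+1}`. By induction,
each iteration gains a factor `ε` and loses one derivative (`uniformDerivBound_slowRhs_succ_sub`).
This needs derivative bounds uniform in `ε`, so `UniformDerivBound` tracks whole families with an
`ε`-dependent weight. The analytic input is that the solution map `(x, z) ↦ y` of `g(x, y) = z` has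
bounded derivatives of orders `1, …, K+1` (`uniformDerivBound_fastSolve`), because strong
dissipativity makes `(x, y) ↦ (x, g(x, y))` globally invertible with Lipschitz inverse. -/

/-! ### Calculus of families with uniformly bounded derivatives -/

/-- A family `h` of `C^m` maps whose derivatives of all orders `j` with `l ≤ j ≤ m` are bounded
by a common multiple of the weight `w`. -/
structure UniformDerivBound {ι E F : Type*} [NormedAddCommGroup E] [NormedSpace ℝ E]
    [NormedAddCommGroup F] [NormedSpace ℝ F] (l m : ℕ) (w : ι → ℝ) (h : ι → E → F) : Prop where
  contDiff : ∀ i, ContDiff ℝ m (h i)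
  bounded : ∃ B : ℝ, ∀ i, ∀ j : ℕ, l ≤ j → j ≤ m → ∀ p, ‖iteratedFDeriv ℝ j (h i) p‖ ≤ B * w i

theorem HasBoundedDerivs.uniformDerivBound {V W : Type*} [NormedAddCommGroup V] [NormedSpace ℝ V]
    [NormedAddCommGroup W] [NormedSpace ℝ W] {l m : ℕ} {F : V → W}
    (h : HasBoundedDerivs l m F) (ι : Type*) :
    UniformDerivBound l m (fun _ : ι => (1 : ℝ)) (fun _ => F) := by
  obtain ⟨B, hB⟩ := h.bounded
  exact ⟨fun _ => h.contDiff, B, fun _ j h1 h2 p => by simpa using hB j h1 h2 p⟩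

namespace UniformDerivBound

variable {ι : Type*} {E F G H : Type*} [NormedAddCommGroup E] [NormedSpace ℝ E]
  [NormedAddCommGroup F] [NormedSpace ℝ F] [NormedAddCommGroup G] [NormedSpace ℝ G]
  [NormedAddCommGroup H] [NormedSpace ℝ H] {l m : ℕ} {w w₁ w₂ : ι → ℝ}

theorem mono {l' m' : ℕ} {h : ι → E → F} (hh : UniformDerivBound l m w h) (hl : l ≤ l')
    (hm : m' ≤ m) : UniformDerivBound l' m' w h := by
  obtain ⟨B, hB⟩ := hh.bounded
  exact ⟨fun i => (hh.contDiff i).of_le (by exact_mod_cast hm), B,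
    fun i j h1 h2 p => hB i j (hl.trans h1) (h2.trans hm) p⟩

theorem exists_nonneg_bound {h : ι → E → F} (hh : UniformDerivBound l m w h)
    (hw : ∀ i, 0 ≤ w i) : ∃ B : ℝ, 0 ≤ B ∧ ∀ i, ∀ j : ℕ, l ≤ j → j ≤ m → ∀ p,
      ‖iteratedFDeriv ℝ j (h i) p‖ ≤ B * w i := by
  obtain ⟨B, hB⟩ := hh.bounded
  exact ⟨max B 0, le_max_right _ _, fun i j h1 h2 p => (hB i j h1 h2 p).trans
    (mul_le_mul_of_nonneg_right (le_max_left _ _) (hw i))⟩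

theorem norm_le {h : ι → E → F} (hh : UniformDerivBound 0 m w h) :
    ∃ B : ℝ, ∀ i p, ‖h i p‖ ≤ B * w i := by
  obtain ⟨B, hB⟩ := hh.bounded
  exact ⟨B, fun i p => by simpa using hB i 0 le_rfl (Nat.zero_le _) p⟩

theorem fderiv {h : ι → E → F} (hh : UniformDerivBound 1 (m + 1) w h) :
    UniformDerivBound 0 m w (fun i => fderiv ℝ (h i)) := by
  obtain ⟨B, hB⟩ := hh.bounded
  refine ⟨fun i => (hh.contDiff i).fderiv_right (by norm_cast), B, fun i j _ h2 p => ?_⟩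
  rw [norm_iteratedFDeriv_fderiv]
  exact hB i (j + 1) (by omega) (by omega) p

theorem of_fderiv {h : ι → E → F} (hd : ∀ i, Differentiable ℝ (h i))
    (hh : UniformDerivBound 0 m w (fun i => _root_.fderiv ℝ (h i))) :
    UniformDerivBound 1 (m + 1) w h := by
  obtain ⟨B, hB⟩ := hh.bounded
  refine ⟨fun i => ?_, B, fun i j h1 h2 p => ?_⟩
  · have := hh.contDiff i
    push_cast
    rw [contDiff_succ_iff_fderiv]
    exact ⟨hd i, by simp, this⟩
  · obtain ⟨j, rfl⟩ : ∃ j', j = j' + 1 := ⟨j - 1, by omega⟩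
    rw [← norm_iteratedFDeriv_fderiv]
    exact hB i j (Nat.zero_le _) (by omega) p

theorem of_norm_le {h : ι → E → F} (hh : UniformDerivBound 1 m w h) (hw : ∀ i, 0 ≤ w i)
    (hb : ∃ B : ℝ, ∀ i p, ‖h i p‖ ≤ B * w i) : UniformDerivBound 0 m w h := by
  obtain ⟨B, hB⟩ := hh.bounded
  obtain ⟨B', hB'⟩ := hb
  refine ⟨hh.contDiff, max B B', fun i j _ h2 p => ?_⟩
  rcases Nat.eq_zero_or_pos j with rfl | hj
  · rw [norm_iteratedFDeriv_zero]
    exact (hB' i p).trans (mul_le_mul_of_nonneg_right (le_max_right _ _) (hw i))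
  · exact (hB i j hj h2 p).trans (mul_le_mul_of_nonneg_right (le_max_left _ _) (hw i))

/-- Base case of the inductions on `m` below: the range `1 ≤ j ≤ 0` is empty, so continuity is
enough. -/
theorem of_continuous {h : ι → E → F} (hc : ∀ i, Continuous (h i)) :
    UniformDerivBound 1 0 w h :=
  ⟨fun i => by exact_mod_cast contDiff_zero (𝕜 := ℝ).2 (hc i), 0, fun i j h1 h2 p => by omega⟩

theorem differentiable {h : ι → E → F} (hh : UniformDerivBound l (m + 1) w h) (i : ι) :
    Differentiable ℝ (h i) :=
  (hh.contDiff i).differentiable (by simp)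

theorem norm_fderiv_le {h : ι → E → F} (hh : UniformDerivBound 1 (m + 1) w h) :
    ∃ B : ℝ, ∀ i p, ‖_root_.fderiv ℝ (h i) p‖ ≤ B * w i := hh.fderiv.norm_le

theorem norm_sub_le {h : ι → E → F} (hh : UniformDerivBound 1 (m + 1) w h) :
    ∃ B : ℝ, ∀ i p q, ‖h i p - h i q‖ ≤ B * w i * ‖p - q‖ := by
  obtain ⟨B, hB⟩ := hh.norm_fderiv_le
  refine ⟨B, fun i p q => ?_⟩
  exact Convex.norm_image_sub_le_of_norm_fderiv_le (fun x _ => hh.differentiable i x)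
    (fun x _ => hB i x) convex_univ (mem_univ _) (mem_univ _)

theorem const (c : F) : UniformDerivBound 0 m (fun _ : ι => (1 : ℝ)) (fun _ (_ : E) => c) := by
  refine ⟨fun i => contDiff_const, ‖c‖, fun i j _ _ p => ?_⟩
  rcases Nat.eq_zero_or_pos j with rfl | hj
  · simp
  · rw [iteratedFDeriv_const_of_ne hj.ne']
    simp

theorem clm (L : E →L[ℝ] F) :
    UniformDerivBound 1 m (fun _ : ι => (1 : ℝ)) (fun _ p => L p) := by
  refine mono (m := m + 1) (of_fderiv (fun _ => L.differentiable) ?_) le_rfl (Nat.le_succ m)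
  convert const (ι := ι) (E := E) (m := m) L using 3 with i p
  exact L.fderiv

theorem bilinear (L : E →L[ℝ] F →L[ℝ] G) {u : ι → H → E} {v : ι → H → F}
    (hu : UniformDerivBound 0 m w₁ u) (hv : UniformDerivBound 0 m w₂ v)
    (hw₁ : ∀ i, 0 ≤ w₁ i) (hw₂ : ∀ i, 0 ≤ w₂ i) :
    UniformDerivBound 0 m (fun i => w₁ i * w₂ i) (fun i p => L (u i p) (v i p)) := by
  obtain ⟨A, hA0, hA⟩ := hu.exists_nonneg_bound hw₁
  obtain ⟨B, hB0, hB⟩ := hv.exists_nonneg_bound hw₂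
  refine ⟨fun i => L.isBoundedBilinearMap.contDiff.comp ((hu.contDiff i).prodMk (hv.contDiff i)),
    ‖L‖ * (2 ^ m * (A * B)), fun i j _ hj p => ?_⟩
  have hAw := mul_nonneg hA0 (hw₁ i)
  have hBw := mul_nonneg hB0 (hw₂ i)
  calc _ ≤ ‖L‖ * ∑ r ∈ Finset.range (j + 1), (j.choose r : ℝ) * ‖iteratedFDeriv ℝ r (u i) p‖ *
          ‖iteratedFDeriv ℝ (j - r) (v i) p‖ :=
        L.norm_iteratedFDeriv_le_of_bilinear (hu.contDiff i) (hv.contDiff i) p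
          (by exact_mod_cast hj)
    _ ≤ ‖L‖ * ∑ r ∈ Finset.range (j + 1), (j.choose r : ℝ) * (A * w₁ i) * (B * w₂ i) := by
        gcongr with r hr
        · exact hA i r (Nat.zero_le _) (by have := Finset.mem_range.1 hr; omega) p
        · exact hB i (j - r) (Nat.zero_le _) (by omega) p
    _ = ‖L‖ * (2 ^ j * ((A * w₁ i) * (B * w₂ i))) := by
        simp_rw [mul_assoc]
        rw [← Finset.sum_mul]
        congr 2
        exact_mod_cast Nat.sum_range_choose j
    _ ≤ ‖L‖ * (2 ^ m * ((A * w₁ i) * (B * w₂ i))) := by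
        gcongr
        norm_num
    _ = _ := by ring

theorem bilinear_one (L : E →L[ℝ] F →L[ℝ] G) {u : ι → H → E} {v : ι → H → F}
    (hu : UniformDerivBound 0 m (fun _ => 1) u) (hv : UniformDerivBound 0 m w v)
    (hw : ∀ i, 0 ≤ w i) : UniformDerivBound 0 m w (fun i p => L (u i p) (v i p)) := by
  simpa using bilinear L hu hv (fun _ => zero_le_one) hw

theorem add {u v : ι → E → F} (hu : UniformDerivBound l m w u)
    (hv : UniformDerivBound l m w v) : UniformDerivBound l m w (fun i p => u i p + v i p) := by
  obtain ⟨A, hA⟩ := hu.bounded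
  obtain ⟨B, hB⟩ := hv.bounded
  refine ⟨fun i => (hu.contDiff i).add (hv.contDiff i), A + B, fun i j h1 h2 p => ?_⟩
  have h2' : (j : WithTop ℕ∞) ≤ m := by exact_mod_cast h2
  rw [fun_iteratedFDeriv_add_apply ((hu.contDiff i).contDiffAt.of_le h2')
    ((hv.contDiff i).contDiffAt.of_le h2'), add_mul]
  exact (norm_add_le _ _).trans (add_le_add (hA i j h1 h2 p) (hB i j h1 h2 p))

theorem clm_comp (L : F →L[ℝ] G) {u : ι → E → F} (hu : UniformDerivBound l m w u) :
    UniformDerivBound l m w (fun i p => L (u i p)) := by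
  obtain ⟨A, hA⟩ := hu.bounded
  refine ⟨fun i => L.contDiff.comp (hu.contDiff i), ‖L‖ * A, fun i j h1 h2 p => ?_⟩
  rw [mul_assoc]
  exact (L.norm_iteratedFDeriv_comp_left (hu.contDiff i).contDiffAt (by exact_mod_cast h2)).trans
    (mul_le_mul_of_nonneg_left (hA i j h1 h2 p) (norm_nonneg _))

theorem prodMk {u : ι → E → F} {v : ι → E → G} (hu : UniformDerivBound l m w u)
    (hv : UniformDerivBound l m w v) :
    UniformDerivBound l m w (fun i p => (u i p, v i p)) := by
  simpa using (clm_comp (ContinuousLinearMap.inl ℝ F G) hu).add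
    (clm_comp (ContinuousLinearMap.inr ℝ F G) hv)

theorem smul_weight {u : ι → E → F} (hu : UniformDerivBound l m w u) (c : ι → ℝ)
    (hc : ∀ i, 0 ≤ c i) : UniformDerivBound l m (fun i => c i * w i) (fun i p => c i • u i p) := by
  obtain ⟨A, hA⟩ := hu.bounded
  refine ⟨fun i => (hu.contDiff i).const_smul (c i), A, fun i j h1 h2 p => ?_⟩
  rw [iteratedFDeriv_const_smul_apply'
    ((hu.contDiff i).contDiffAt.of_le (by exact_mod_cast h2)), norm_smul, Real.norm_eq_abs,
    abs_of_nonneg (hc i), mul_left_comm]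
  exact mul_le_mul_of_nonneg_left (hA i j h1 h2 p) (hc i)

end UniformDerivBound

namespace UniformDerivBound

universe u

variable {ι : Type*} {E H : Type u} [NormedAddCommGroup E] [NormedSpace ℝ E]
  [NormedAddCommGroup H] [NormedSpace ℝ H] {w : ι → ℝ}

/-- Induction on `m` through the chain rule, applying the hypothesis to `Dg`. The target changes
from `F` to `E →L[ℝ] F`, whence the generalization over `F` and the common universe. Starting at
order `1` admits unbounded inner maps such as `x ↦ (x, Γ x)`. -/
theorem comp {m : ℕ} {F : Type u} [NormedAddCommGroup F] [NormedSpace ℝ F]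
    {g : ι → E → F} {u : ι → H → E}
    (hg : UniformDerivBound 1 m (fun _ => 1) g) (hu : UniformDerivBound 1 m (fun _ => 1) u) :
    UniformDerivBound 1 m (fun _ => 1) (fun i p => g i (u i p)) := by
  induction m generalizing F with
  | zero => exact of_continuous fun i => (hg.contDiff i).continuous.comp (hu.contDiff i).continuous
  | succ m ih =>
    refine of_fderiv (fun i => (hg.differentiable i).comp (hu.differentiable i)) ?_
    have h1 : UniformDerivBound 0 m (fun _ => 1) (fun i p => _root_.fderiv ℝ (g i) (u i p)) := by
      obtain ⟨B, hB⟩ := hg.norm_fderiv_le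
      exact of_norm_le (ih (hg.fderiv.mono (Nat.zero_le _) le_rfl)
        (hu.mono le_rfl (Nat.le_succ m))) (fun _ => zero_le_one) ⟨B, fun i p => hB i _⟩
    convert bilinear_one (ContinuousLinearMap.compL ℝ H E F) h1 hu.fderiv
      (fun _ => zero_le_one) using 3 with i p
    exact fderiv_comp p (hg.differentiable i _) (hu.differentiable i p)

theorem comp_zero {m : ℕ} {F : Type u} [NormedAddCommGroup F] [NormedSpace ℝ F]
    {g : ι → E → F} {u : ι → H → E}
    (hg : UniformDerivBound 0 m (fun _ => 1) g) (hu : UniformDerivBound 1 m (fun _ => 1) u) :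
    UniformDerivBound 0 m (fun _ => 1) (fun i p => g i (u i p)) := by
  obtain ⟨B, hB⟩ := hg.norm_le
  exact of_norm_le (comp (hg.mono (Nat.zero_le _) le_rfl) hu) (fun _ => zero_le_one)
    ⟨B, fun i p => hB i _⟩

/-- Differences keep their weight because `D(g∘u) - D(g∘v) = (Dg(u) - Dg(v)) Du + Dg(v) (Du - Dv)`.
The order-zero bound for `Dg(u) - Dg(v)` uses that `Dg` is Lipschitz, hence the extra derivative of
`g`. -/
theorem comp_sub_comp {m : ℕ} {F : Type u} [NormedAddCommGroup F] [NormedSpace ℝ F]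
    {g : ι → E → F} {u v : ι → H → E} (hw : ∀ i, 0 ≤ w i)
    (hg : UniformDerivBound 1 (m + 1) (fun _ => 1) g)
    (hu : UniformDerivBound 1 m (fun _ => 1) u) (hv : UniformDerivBound 1 m (fun _ => 1) v)
    (huv : UniformDerivBound 0 m w (fun i p => u i p - v i p)) :
    UniformDerivBound 0 m w (fun i p => g i (u i p) - g i (v i p)) := by
  have hbound : ∃ B : ℝ, ∀ i p, ‖g i (u i p) - g i (v i p)‖ ≤ B * w i := by
    obtain ⟨A, hA⟩ := hg.norm_sub_le
    obtain ⟨B, hB⟩ := huv.norm_le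
    refine ⟨max A 0 * B, fun i p => (hA i _ _).trans ?_⟩
    calc A * 1 * ‖u i p - v i p‖ ≤ max A 0 * (B * w i) := by
          rw [mul_one]
          exact mul_le_mul (le_max_left _ _) (hB i p) (norm_nonneg _) (le_max_right _ _)
      _ = _ := by ring
  refine of_norm_le ?_ hw hbound
  clear hbound
  induction m generalizing F with
  | zero =>
    exact of_continuous fun i => ((hg.contDiff i).continuous.comp (hu.contDiff i).continuous).sub
      ((hg.contDiff i).continuous.comp (hv.contDiff i).continuous)
  | succ m ih =>
    have hdg := fun i => hg.differentiable i
    have hdu := fun i => hu.differentiable i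
    have hdv := fun i => hv.differentiable i
    refine of_fderiv (fun i => ((hdg i).comp (hdu i)).sub ((hdg i).comp (hdv i))) ?_
    have hu' := hu.mono le_rfl (Nat.le_succ m)
    have hv' := hv.mono le_rfl (Nat.le_succ m)
    have huv' := huv.mono le_rfl (Nat.le_succ m)
    have hdiff : UniformDerivBound 0 m w
        (fun i p => _root_.fderiv ℝ (g i) (u i p) - _root_.fderiv ℝ (g i) (v i p)) := by
      have h1 := hg.fderiv.mono (Nat.zero_le 1) le_rfl
      refine of_norm_le (ih h1 hu' hv' huv') hw ?_
      obtain ⟨A, hA⟩ := h1.norm_sub_le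
      obtain ⟨B, hB⟩ := huv.norm_le
      refine ⟨max A 0 * B, fun i p => (hA i _ _).trans ?_⟩
      calc A * 1 * ‖u i p - v i p‖ ≤ max A 0 * (B * w i) := by
            rw [mul_one]
            exact mul_le_mul (le_max_left _ _) (hB i p) (norm_nonneg _) (le_max_right _ _)
        _ = _ := by ring
    have hgv : UniformDerivBound 0 m (fun _ => 1) (fun i p => _root_.fderiv ℝ (g i) (v i p)) :=
      comp_zero (hg.fderiv.mono le_rfl (Nat.le_succ m)) hv'
    have hduv : UniformDerivBound 0 m w
        (fun i p => _root_.fderiv ℝ (u i) p - _root_.fderiv ℝ (v i) p) := by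
      convert (huv.mono (Nat.zero_le 1) le_rfl).fderiv using 3 with i p
      exact (fderiv_fun_sub (hdu i p) (hdv i p)).symm
    convert (bilinear_one (ContinuousLinearMap.compL ℝ H E F).flip hu.fderiv hdiff hw).add
      (bilinear_one (ContinuousLinearMap.compL ℝ H E F) hgv hduv hw) using 3 with i p
    have e1 := fderiv_comp p (hdg i (u i p)) (hdu i p)
    have e2 := fderiv_comp p (hdg i (v i p)) (hdv i p)
    have e3 := fderiv_sub (((hdg i).comp (hdu i)) p) (((hdg i).comp (hdv i)) p)
    refine e3.trans ?_
    rw [e1, e2]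
    ext h
    simp

/-- The derivative of `a⁻¹` is `-a⁻¹ (Da) a⁻¹`, so a bound on the inverse itself propagates to all
orders. -/
theorem ringInverse {m : ℕ} {R : Type u} [NormedRing R] [NormedAlgebra ℝ R]
    [CompleteSpace R]
    {a : ι → H → R} (ha : UniformDerivBound 0 m (fun _ => 1) a)
    (hunit : ∀ i p, IsUnit (a i p)) (hb : ∃ B : ℝ, ∀ i p, ‖Ring.inverse (a i p)‖ ≤ B) :
    UniformDerivBound 0 m (fun _ => 1) (fun i p => Ring.inverse (a i p)) := by
  refine of_norm_le ?_ (fun _ => zero_le_one) (by simpa using hb)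
  have key : ∀ x : R, IsUnit x → HasFDerivAt Ring.inverse
      (-ContinuousLinearMap.mulLeftRight ℝ R (Ring.inverse x) (Ring.inverse x)) x := by
    rintro x ⟨x, rfl⟩
    simpa using hasFDerivAt_ringInverse (𝕜 := ℝ) x
  induction m with
  | zero =>
    refine of_continuous fun i => continuous_iff_continuousAt.2 fun p => ?_
    exact ContinuousAt.comp (key _ (hunit i p)).continuousAt
      (ha.contDiff i).continuous.continuousAt
  | succ m ih =>
    have hd : ∀ i p, HasFDerivAt (fun p => Ring.inverse (a i p)) _ p := fun i p =>
      (key _ (hunit i p)).comp p (ha.differentiable i p).hasFDerivAt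
    refine of_fderiv (fun i p => (hd i p).differentiableAt) ?_
    have h0 : UniformDerivBound 0 m (fun _ => 1) (fun i p => Ring.inverse (a i p)) :=
      of_norm_le (ih (ha.mono le_rfl (Nat.le_succ m))) (fun _ => zero_le_one) (by simpa using hb)
    have h1 := bilinear_one (ContinuousLinearMap.mulLeftRight ℝ R) h0 h0 (fun _ => zero_le_one)
    have h2 := bilinear_one (-ContinuousLinearMap.compL ℝ H R R) h1
      (ha.mono (Nat.zero_le 1) le_rfl).fderiv (fun _ => zero_le_one)
    convert h2 using 3 with i p
    rw [(hd i p).fderiv]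
    ext h
    simp

end UniformDerivBound

/-! ### The equation `g(x, y) = z`: unique solvability and regularity -/

namespace SlowFastAssumptions

variable {nx ny K : ℕ} {β : ℝ}
  {f : EuclideanSpace ℝ (Fin nx) × EuclideanSpace ℝ (Fin ny) → EuclideanSpace ℝ (Fin nx)}
  {g : EuclideanSpace ℝ (Fin nx) × EuclideanSpace ℝ (Fin ny) → EuclideanSpace ℝ (Fin ny)}

theorem exists_lipschitz_g (h : SlowFastAssumptions f g β K) :
    ∃ L : ℝ, β ≤ L ∧ ∀ p q, ‖g p - g q‖ ≤ L * ‖p - q‖ := by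
  obtain ⟨B, hB⟩ := (h.regular_g.uniformDerivBound Unit).norm_sub_le
  -- Enlarging the constant to at least `β` keeps `1 - β²/L²` nonnegative in the contraction
  -- argument.
  refine ⟨max β B, le_max_left _ _, fun p q => (hB () p q).trans ?_⟩
  rw [mul_one]
  exact mul_le_mul_of_nonneg_right (le_max_right _ _) (norm_nonneg _)

theorem eq_of_g_eq (h : SlowFastAssumptions f g β K) {x : EuclideanSpace ℝ (Fin nx)}
    {y₁ y₂ : EuclideanSpace ℝ (Fin ny)} (hg : g (x, y₁) = g (x, y₂)) : y₁ = y₂ := by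
  have h1 := h.dissipative x y₁ y₂
  rw [hg, sub_self, inner_zero_right] at h1
  have h2 : ‖y₁ - y₂‖ ^ 2 ≤ 0 := by
    by_contra! h3
    nlinarith [mul_pos h.beta_pos h3]
  exact sub_eq_zero.1 (norm_eq_zero.1 (pow_eq_zero_iff two_ne_zero |>.1
    (le_antisymm h2 (sq_nonneg _))))

theorem exists_solution (h : SlowFastAssumptions f g β K) (x : EuclideanSpace ℝ (Fin nx))
    (z : EuclideanSpace ℝ (Fin ny)) : ∃ y, g (x, y) = z := by
  obtain ⟨L, hβL, hL⟩ := h.exists_lipschitz_g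
  have hβ := h.beta_pos
  have hLpos : 0 < L := hβ.trans_le hβL
  -- The map `y ↦ y + τ (g(x, y) - z)` has squared Lipschitz constant at most `1 - 2τβ + τ²L²`,
  -- minimized by this `τ`.
  set τ := β / L ^ 2 with hτ
  have hτpos : 0 < τ := by positivity
  have hq1 : 1 - β ^ 2 / L ^ 2 < 1 := by
    have : 0 < β ^ 2 / L ^ 2 := by positivity
    linarith
  have hq0 : 0 ≤ 1 - β ^ 2 / L ^ 2 := by
    rw [sub_nonneg, div_le_one (by positivity)]
    gcongr
  have hcontr : ContractingWith (Real.toNNReal (Real.sqrt (1 - β ^ 2 / L ^ 2)))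
      (fun y => y + τ • (g (x, y) - z)) := by
    constructor
    · rw [Real.toNNReal_lt_one, Real.sqrt_lt' one_pos]
      simpa using hq1
    · refine LipschitzWith.of_dist_le_mul fun y₁ y₂ => ?_
      rw [Real.coe_toNNReal _ (Real.sqrt_nonneg _), dist_eq_norm, dist_eq_norm]
      have e : y₁ + τ • (g (x, y₁) - z) - (y₂ + τ • (g (x, y₂) - z)) =
          (y₁ - y₂) + τ • (g (x, y₁) - g (x, y₂)) := by
        simp only [smul_sub]; abel
      rw [e]
      have hw : ‖g (x, y₁) - g (x, y₂)‖ ≤ L * ‖y₁ - y₂‖ := by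
        simpa [Prod.norm_def] using hL (x, y₁) (x, y₂)
      have hsq : ‖(y₁ - y₂) + τ • (g (x, y₁) - g (x, y₂))‖ ^ 2 ≤
          (1 - β ^ 2 / L ^ 2) * ‖y₁ - y₂‖ ^ 2 := by
        rw [norm_add_sq_real, inner_smul_right, norm_smul, Real.norm_eq_abs, abs_of_pos hτpos]
        have h1 := mul_le_mul_of_nonneg_left (h.dissipative x y₁ y₂) hτpos.le
        have h2 : (τ * ‖g (x, y₁) - g (x, y₂)‖) ^ 2 ≤ (τ * (L * ‖y₁ - y₂‖)) ^ 2 := by gcongr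
        have h3 : τ * (-β * ‖y₁ - y₂‖ ^ 2) = -(β ^ 2 / L ^ 2) * ‖y₁ - y₂‖ ^ 2 := by
          rw [hτ]; ring
        have h4 : (τ * (L * ‖y₁ - y₂‖)) ^ 2 = β ^ 2 / L ^ 2 * ‖y₁ - y₂‖ ^ 2 := by
          rw [hτ]; field_simp
        linarith
      refine le_of_sq_le_sq ?_ (by positivity)
      rwa [mul_pow, Real.sq_sqrt hq0]
  refine ⟨hcontr.fixedPoint, ?_⟩
  have hfix := hcontr.fixedPoint_isFixedPt
  simp only [Function.IsFixedPt, add_eq_left, smul_eq_zero, hτpos.ne', false_or] at hfix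
  exact sub_eq_zero.1 hfix

theorem g_fastSolve (h : SlowFastAssumptions f g β K) (x : EuclideanSpace ℝ (Fin nx))
    (z : EuclideanSpace ℝ (Fin ny)) : g (x, fastSolve g x z) = z :=
  Classical.epsilon_spec (h.exists_solution x z)

theorem g_eq_iff (h : SlowFastAssumptions f g β K) (x : EuclideanSpace ℝ (Fin nx))
    (y z : EuclideanSpace ℝ (Fin ny)) : g (x, y) = z ↔ y = fastSolve g x z :=
  ⟨fun hy => h.eq_of_g_eq (hy.trans (h.g_fastSolve x z).symm),
    fun hy => hy ▸ h.g_fastSolve x z⟩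

/-- Dissipativity and Cauchy–Schwarz give `β |a₂ - b₂| ≤ |g(a₁, a₂) - g(a₁, b₂)|`; changing the base
point from `a₁` to `b₁` costs `L |a₁ - b₁|`. -/
theorem exists_antilipschitz (h : SlowFastAssumptions f g β K) :
    ∃ Λ : ℝ, 0 < Λ ∧ ∀ a b : EuclideanSpace ℝ (Fin nx) × EuclideanSpace ℝ (Fin ny),
      ‖a - b‖ ≤ Λ * ‖((a.1, g a) - (b.1, g b) :
        EuclideanSpace ℝ (Fin nx) × EuclideanSpace ℝ (Fin ny))‖ := by
  obtain ⟨L, hβL, hL⟩ := h.exists_lipschitz_g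
  have hβ := h.beta_pos
  have hLpos : 0 < L := hβ.trans_le hβL
  refine ⟨max 1 ((1 + L) / β), by positivity, fun a b => ?_⟩
  set N := ‖((a.1, g a) - (b.1, g b) :
    EuclideanSpace ℝ (Fin nx) × EuclideanSpace ℝ (Fin ny))‖ with hN
  have hN1 : ‖a.1 - b.1‖ ≤ N := le_max_left _ _
  have hN2 : ‖g a - g b‖ ≤ N := le_max_right _ _
  have hN0 : 0 ≤ N := norm_nonneg _
  rw [Prod.norm_def, max_le_iff]
  constructor
  · exact hN1.trans (le_mul_of_one_le_left hN0 (le_max_left _ _))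
  · refine le_trans ?_ (mul_le_mul_of_nonneg_right (le_max_right _ _) hN0)
    rw [div_mul_eq_mul_div, le_div_iff₀ hβ]
    have h1 := h.dissipative a.1 a.2 b.2
    have h2 : ‖g (a.1, a.2) - g (a.1, b.2)‖ ≤ (1 + L) * N := by
      have h3 : ‖g b - g (a.1, b.2)‖ ≤ L * ‖a.1 - b.1‖ := by
        refine (hL b (a.1, b.2)).trans_eq ?_
        simp [Prod.norm_def, norm_sub_rev]
      calc ‖g (a.1, a.2) - g (a.1, b.2)‖ = ‖(g a - g b) + (g b - g (a.1, b.2))‖ := by simp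
        _ ≤ ‖g a - g b‖ + ‖g b - g (a.1, b.2)‖ := norm_add_le _ _
        _ ≤ N + L * N := by gcongr; exact h3.trans (by gcongr)
        _ = _ := by ring
    have h3 := (abs_le.1 (abs_real_inner_le_norm (a.2 - b.2)
      (g (a.1, a.2) - g (a.1, b.2)))).1
    have h4 := mul_le_mul_of_nonneg_left h2 (norm_nonneg (a.2 - b.2))
    change ‖a.2 - b.2‖ * β ≤ _
    rcases (norm_nonneg (a.2 - b.2)).eq_or_lt with h0 | h0
    · rw [← h0, zero_mul]; positivity
    · refine le_of_mul_le_mul_left ?_ h0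
      nlinarith

-- The inverse `Ψ` of `Φ(x, y) = (x, g(x, y))` is Lipschitz and satisfies `DΨ = (DΦ ∘ Ψ)⁻¹`. This
-- identity bootstraps: bounds on `Ψ` up to order `m` bound `DΨ` up to order `m`, hence `Ψ` up to
-- order `m + 1`.
set_option synthInstance.maxHeartbeats 200000 in
theorem uniformDerivBound_fastSolve (h : SlowFastAssumptions f g β K) (ι : Type*) :
    UniformDerivBound 1 (K + 1) (fun _ : ι => (1 : ℝ))
      (fun _ (p : EuclideanSpace ℝ (Fin nx) × EuclideanSpace ℝ (Fin ny)) =>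
        fastSolve g p.1 p.2) := by
  obtain ⟨Λ, hΛ0, hΛ⟩ := h.exists_antilipschitz
  have hg := h.regular_g.uniformDerivBound ι
  have hgd : Differentiable ℝ g := h.regular_g.contDiff.differentiable (by simp)
  set Φ : EuclideanSpace ℝ (Fin nx) × EuclideanSpace ℝ (Fin ny) →
    EuclideanSpace ℝ (Fin nx) × EuclideanSpace ℝ (Fin ny) := fun p => (p.1, g p) with hΦ
  set Ψ : EuclideanSpace ℝ (Fin nx) × EuclideanSpace ℝ (Fin ny) →
    EuclideanSpace ℝ (Fin nx) × EuclideanSpace ℝ (Fin ny) :=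
    fun p => (p.1, fastSolve g p.1 p.2) with hΨ
  have hΦΨ : ∀ p, Φ (Ψ p) = p := fun p => by simp [hΦ, hΨ, h.g_fastSolve]
  have hΦb : UniformDerivBound 1 (K + 1) (fun _ : ι => (1 : ℝ)) (fun _ => Φ) :=
    (UniformDerivBound.clm (ContinuousLinearMap.fst ℝ _ _)).prodMk hg
  have hΦd : Differentiable ℝ Φ := differentiable_fst.prodMk hgd
  have hΨlip : LipschitzWith Λ.toNNReal Ψ := by
    refine LipschitzWith.of_dist_le_mul fun p q => ?_
    have := hΛ (Ψ p) (Ψ q)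
    rw [Real.coe_toNNReal _ hΛ0.le, dist_eq_norm, dist_eq_norm]
    change _ ≤ Λ * ‖Φ (Ψ p) - Φ (Ψ q)‖ at this
    rwa [hΦΨ, hΦΨ] at this
  have hunit : ∀ a, IsUnit (fderiv ℝ Φ a) := by
    intro a
    rw [ContinuousLinearMap.isUnit_iff_bijective]
    -- The anti-Lipschitz bound passes to the limit of difference quotients; injectivity then yields
    -- invertibility in finite dimension.
    have hbound : ∀ v, ‖v‖ ≤ Λ * ‖fderiv ℝ Φ a v‖ := by
      intro v
      have hlim := ((hΦd a).hasFDerivAt.lim_real v).norm.const_mul Λ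
      refine ge_of_tendsto hlim ?_
      filter_upwards [Filter.eventually_gt_atTop 0] with c hc
      have h1 := mul_le_mul_of_nonneg_left (hΛ (a + c⁻¹ • v) a) hc.le
      rw [add_sub_cancel_left, norm_smul, norm_inv, Real.norm_eq_abs, abs_of_pos hc,
        mul_inv_cancel_left₀ hc.ne'] at h1
      rw [norm_smul, Real.norm_eq_abs, abs_of_pos hc, mul_left_comm]
      exact h1
    have hinj : Function.Injective (fderiv ℝ Φ a).toLinearMap := by
      rw [injective_iff_map_eq_zero]
      intro v hv
      have := hbound v
      rw [show fderiv ℝ Φ a v = 0 from hv, norm_zero, mul_zero] at this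
      exact norm_le_zero_iff.1 this
    exact ⟨hinj, LinearMap.surjective_of_injective hinj⟩
  have hΨd : ∀ p, HasFDerivAt Ψ (Ring.inverse (fderiv ℝ Φ (Ψ p))) p := by
    intro p
    obtain ⟨e, he⟩ := hunit (Ψ p)
    have hd := (hΦd (Ψ p)).hasFDerivAt
    rw [← he, Ring.inverse_unit]
    rw [← he] at hd
    exact HasFDerivAt.of_local_left_inverse (f' := ContinuousLinearEquiv.ofUnit e)
      hΨlip.continuous.continuousAt hd (Filter.Eventually.of_forall hΦΨ)
  have hinv : ∃ B : ℝ, ∀ (i : ι) p, ‖Ring.inverse (fderiv ℝ Φ (Ψ p))‖ ≤ B := by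
    refine ⟨Λ.toNNReal, fun _ p => ?_⟩
    rw [← (hΨd p).fderiv]
    exact norm_fderiv_le_of_lipschitz ℝ hΨlip
  have hΨb : ∀ m ≤ K + 1, UniformDerivBound 1 m (fun _ : ι => (1 : ℝ)) (fun _ => Ψ) := by
    intro m
    induction m with
    | zero => exact fun _ => UniformDerivBound.of_continuous fun _ => hΨlip.continuous
    | succ m ih =>
      intro hm
      refine UniformDerivBound.of_fderiv (fun _ p => (hΨd p).differentiableAt) ?_
      have h1 := (hΦb.fderiv.mono le_rfl (by omega : m ≤ K)).comp_zero (ih (by omega))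
      rw [show fderiv ℝ Ψ = fun p => Ring.inverse (fderiv ℝ Φ (Ψ p)) from
        funext fun p => (hΨd p).fderiv]
      exact h1.ringInverse (fun _ p => hunit _) hinv
  exact (hΨb _ le_rfl).clm_comp (ContinuousLinearMap.snd ℝ _ _)

end SlowFastAssumptions

/-! ### The iterates and their defect -/

namespace SlowFastAssumptions

variable {nx ny K : ℕ} {β : ℝ}
  {f : EuclideanSpace ℝ (Fin nx) × EuclideanSpace ℝ (Fin ny) → EuclideanSpace ℝ (Fin nx)}
  {g : EuclideanSpace ℝ (Fin nx) × EuclideanSpace ℝ (Fin ny) → EuclideanSpace ℝ (Fin ny)}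

theorem graph_uniformDerivBound {ι : Type*} {m : ℕ}
    {Γ : ι → EuclideanSpace ℝ (Fin nx) → EuclideanSpace ℝ (Fin ny)}
    (hΓ : UniformDerivBound 1 m (fun _ => 1) Γ) :
    UniformDerivBound 1 m (fun _ => 1) (fun i x => (x, Γ i x)) :=
  (UniformDerivBound.clm (ContinuousLinearMap.id ℝ _)).prodMk hΓ

theorem uniformDerivBound_iterRhs (h : SlowFastAssumptions f g β K) {ι : Type*} {m : ℕ}
    (hm : m ≤ K) {Γ : ι → EuclideanSpace ℝ (Fin nx) → EuclideanSpace ℝ (Fin ny)}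
    (hΓ : UniformDerivBound 1 (m + 1) (fun _ => 1) Γ) (ε : ι → ℝ) (hε : ∀ i, 0 ≤ ε i) :
    UniformDerivBound 0 m ε (fun i => iterRhs f (ε i) (Γ i)) := by
  have hf : UniformDerivBound 0 m (fun _ : ι => (1 : ℝ)) (fun _ => f) :=
    (h.regular_f.uniformDerivBound ι).mono le_rfl (hm.trans (le_max_left _ _))
  have h1 := (hΓ.fderiv.bilinear_one (ContinuousLinearMap.id ℝ _)
    (hf.comp_zero (graph_uniformDerivBound (hΓ.mono le_rfl (Nat.le_succ m))))
    (fun _ => zero_le_one)).smul_weight ε hε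
  simp only [mul_one] at h1
  exact h1

/-- The right-hand side of the equation `g (x, y) = z` defining the `k`-th iterate. -/
noncomputable def slowRhs
    (f : EuclideanSpace ℝ (Fin nx) × EuclideanSpace ℝ (Fin ny) → EuclideanSpace ℝ (Fin nx))
    (g : EuclideanSpace ℝ (Fin nx) × EuclideanSpace ℝ (Fin ny) → EuclideanSpace ℝ (Fin ny))
    (ε : ℝ) : ℕ → EuclideanSpace ℝ (Fin nx) → EuclideanSpace ℝ (Fin ny)
  | 0 => fun _ => 0
  | k + 1 => iterRhs f ε (slowIterate f g ε k)

theorem slowIterate_eq (ε : ℝ) (k : ℕ) (x : EuclideanSpace ℝ (Fin nx)) :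
    slowIterate f g ε k x = fastSolve g x (slowRhs f g ε k x) := by
  cases k <;> rfl

theorem uniformDerivBound_slowIterate_of_slowRhs (h : SlowFastAssumptions f g β K) {ι : Type*}
    (ε : ι → ℝ) {k m : ℕ} (hm : m ≤ K + 1)
    (hr : UniformDerivBound 1 m (fun _ => 1) (fun i => slowRhs f g (ε i) k)) :
    UniformDerivBound 1 m (fun _ => 1) (fun i => slowIterate f g (ε i) k) := by
  simp only [funext (slowIterate_eq (f := f) (g := g) _ k)]
  exact ((h.uniformDerivBound_fastSolve ι).mono le_rfl hm).comp (graph_uniformDerivBound hr)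

theorem uniformDerivBound_slowRhs (h : SlowFastAssumptions f g β K) {ι : Type*}
    (ε : ι → ℝ) (hε : ∀ i, 0 ≤ ε i) {ε₀ : ℝ} (hε₀ : ∀ i, ε i ≤ ε₀) (k : ℕ) (hk : k ≤ K + 1) :
    UniformDerivBound 1 (K + 1 - k) (fun _ => 1) (fun i => slowRhs f g (ε i) k) := by
  induction k with
  | zero => exact (UniformDerivBound.const 0).mono (Nat.zero_le _) le_rfl
  | succ k ih =>
    have h1 := h.uniformDerivBound_iterRhs (m := K + 1 - (k + 1)) (by omega)
      (h.uniformDerivBound_slowIterate_of_slowRhs ε (by omega)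
        ((ih (by omega)).mono le_rfl (by omega))) ε hε
    obtain ⟨B, hB0, hB⟩ := h1.exists_nonneg_bound hε
    -- The weight `ε` is traded for the constant `ε₀`; only boundedness uniform in `ε` is needed
    -- here.
    exact ⟨h1.contDiff, B * ε₀, fun i j _ h2 p => (hB i j (Nat.zero_le _) h2 p).trans
      (by rw [mul_one]; exact mul_le_mul_of_nonneg_left (hε₀ i) hB0)⟩

theorem uniformDerivBound_slowIterate (h : SlowFastAssumptions f g β K) {ι : Type*}
    (ε : ι → ℝ) (hε : ∀ i, 0 ≤ ε i) {ε₀ : ℝ} (hε₀ : ∀ i, ε i ≤ ε₀) (k : ℕ) (hk : k ≤ K) :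
    UniformDerivBound 1 (K + 1 - k) (fun _ => 1) (fun i => slowIterate f g (ε i) k) :=
  h.uniformDerivBound_slowIterate_of_slowRhs ε (Nat.sub_le _ _)
    (h.uniformDerivBound_slowRhs ε hε hε₀ k (by omega))

/-- Since `g(x, Γ_k(x))` equals the `k`-th right-hand side, this bounds the defect of `Γ_k`. The
solution map transfers the bound to `Γ_{k+1} - Γ_k`; differentiating costs one order and the
prefactor `ε` supplies the next power. For `k = K` exactly the sup bound is left. -/
theorem uniformDerivBound_slowRhs_succ_sub (h : SlowFastAssumptions f g β K) {ι : Type*}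
    (ε : ι → ℝ) (hε : ∀ i, 0 ≤ ε i) {ε₀ : ℝ} (hε₀ : ∀ i, ε i ≤ ε₀) (k : ℕ) (hk : k ≤ K) :
    UniformDerivBound 0 (K - k) (fun i => ε i ^ (k + 1))
      (fun i x => slowRhs f g (ε i) (k + 1) x - slowRhs f g (ε i) k x) := by
  induction k with
  | zero =>
    simpa [slowRhs] using h.uniformDerivBound_iterRhs (m := K) le_rfl
      (h.uniformDerivBound_slowIterate ε hε hε₀ 0 (Nat.zero_le _)) ε hε
  | succ k ih =>
    have hw : ∀ i, 0 ≤ ε i ^ (k + 1) := fun i => pow_nonneg (hε i) _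
    have hr := ih (by omega)
    have hΓ := h.uniformDerivBound_slowIterate ε hε hε₀ k (by omega)
    have hΓ' := h.uniformDerivBound_slowIterate ε hε hε₀ (k + 1) hk
    obtain ⟨m, hm⟩ : ∃ m, K - k = m + 1 := ⟨K - k - 1, by omega⟩
    rw [show K - (k + 1) = m by omega]
    rw [show K + 1 - k = m + 2 by omega] at hΓ
    rw [show K + 1 - (k + 1) = m + 1 by omega] at hΓ'
    rw [hm] at hr
    have hdiff : UniformDerivBound 0 (m + 1) (fun i => ε i ^ (k + 1))
        (fun i x => slowIterate f g (ε i) (k + 1) x - slowIterate f g (ε i) k x) := by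
      simp only [slowIterate_eq]
      refine UniformDerivBound.comp_sub_comp hw
        ((h.uniformDerivBound_fastSolve ι).mono le_rfl (by omega : m + 2 ≤ K + 1))
        (u := fun i x => (x, slowRhs f g (ε i) (k + 1) x))
        (v := fun i x => (x, slowRhs f g (ε i) k x)) ?_ ?_ ?_
      · exact graph_uniformDerivBound
          ((h.uniformDerivBound_slowRhs ε hε hε₀ (k + 1) (by omega)).mono le_rfl (by omega))
      · exact graph_uniformDerivBound
          ((h.uniformDerivBound_slowRhs ε hε hε₀ k (by omega)).mono le_rfl (by omega))
      · simpa using hr.clm_comp (ContinuousLinearMap.inr ℝ (EuclideanSpace ℝ (Fin nx)) _)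
    have hf : UniformDerivBound 0 (m + 1) (fun _ : ι => (1 : ℝ)) (fun _ => f) :=
      (h.regular_f.uniformDerivBound ι).mono le_rfl (le_trans (by omega) (le_max_left _ _))
    have hgr := graph_uniformDerivBound (hΓ.mono le_rfl (by omega : m ≤ m + 2))
    have hgr' := graph_uniformDerivBound (hΓ'.mono le_rfl (by omega : m ≤ m + 1))
    have hfdiff : UniformDerivBound 0 m (fun i => ε i ^ (k + 1))
        (fun i x => f (x, slowIterate f g (ε i) (k + 1) x) - f (x, slowIterate f g (ε i) k x)) := by
      refine UniformDerivBound.comp_sub_comp hw (hf.mono (Nat.zero_le _) le_rfl) hgr' hgr ?_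
      simpa using (hdiff.mono le_rfl (Nat.le_succ m)).clm_comp
        (ContinuousLinearMap.inr ℝ (EuclideanSpace ℝ (Fin nx)) _)
    have hDdiff : UniformDerivBound 0 m (fun i => ε i ^ (k + 1))
        (fun i x => fderiv ℝ (slowIterate f g (ε i) (k + 1)) x -
          fderiv ℝ (slowIterate f g (ε i) k) x) := by
      convert (hdiff.mono (Nat.zero_le 1) le_rfl).fderiv using 3 with i x
      exact (fderiv_fun_sub (hΓ'.differentiable i x) (hΓ.differentiable i x)).symm
    -- With primes for index `k + 1`: `DΓ' f' - DΓ f = (DΓ' - DΓ) f' + DΓ (f' - f)`.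
    have h1 := hDdiff.bilinear (ContinuousLinearMap.id ℝ _)
      ((hf.mono le_rfl (Nat.le_succ m)).comp_zero hgr') hw (fun _ => zero_le_one)
    have h2 := (hΓ.fderiv.mono le_rfl (Nat.le_succ m)).bilinear_one (ContinuousLinearMap.id ℝ _)
      hfdiff hw
    simp only [mul_one] at h1
    have h3 := (h1.add h2).smul_weight ε hε
    convert h3 using 3 with i i x
    · ring
    · simp only [slowRhs, iterRhs, ContinuousLinearMap.id_apply, sub_apply,
        map_sub]
      rw [← smul_sub]
      congr 1
      abel

/-- Uniform bounds on the iterate of order `k` entering the error estimate. -/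
theorem exists_slowIterate_bounds (h : SlowFastAssumptions f g β K) {ε₀ : ℝ} {k : ℕ}
    (hk : k ≤ K) : ∃ A : ℝ, 0 < A ∧ (∀ p q, ‖f p - f q‖ ≤ A * ‖p - q‖) ∧ ∀ ε ∈ Ioc 0 ε₀,
      (∀ x, ‖fderiv ℝ (slowIterate f g ε k) x‖ ≤ A) ∧
      (∀ x x', ‖slowIterate f g ε k x - slowIterate f g ε k x'‖ ≤ A * ‖x - x'‖) ∧
      (∀ x, ‖g (x, slowIterate f g ε k x) - iterRhs f ε (slowIterate f g ε k) x‖ ≤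
        A * ε ^ (k + 1)) := by
  have hε : ∀ i : Ioc 0 ε₀, 0 ≤ (i : ℝ) := fun i => i.2.1.le
  have hε₀ : ∀ i : Ioc 0 ε₀, (i : ℝ) ≤ ε₀ := fun i => i.2.2
  obtain ⟨A₁, hA₁⟩ := (((h.regular_f.uniformDerivBound Unit).mono (Nat.zero_le 1)
    (le_max_right _ _)) : UniformDerivBound 1 (0 + 1) _ _).norm_sub_le
  have hΓ := (h.uniformDerivBound_slowIterate _ hε hε₀ k hk).mono le_rfl
    (by omega : 0 + 1 ≤ K + 1 - k)
  obtain ⟨A₂, hA₂⟩ := hΓ.norm_fderiv_le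
  obtain ⟨A₃, hA₃⟩ := hΓ.norm_sub_le
  obtain ⟨A₄, hA₄⟩ := (h.uniformDerivBound_slowRhs_succ_sub _ hε hε₀ k hk).norm_le
  set A := max 1 (max (max A₁ A₂) (max A₃ A₄)) with hA
  have h1 : A₁ ≤ A := by simp [hA]
  have h2 : A₂ ≤ A := by simp [hA]
  have h3 : A₃ ≤ A := by simp [hA]
  have h4 : A₄ ≤ A := by simp [hA]
  refine ⟨A, lt_max_of_lt_left one_pos, fun p q => ?_, fun ε hεm => ⟨fun x => ?_,
    fun x x' => ?_, fun x => ?_⟩⟩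
  · exact (hA₁ () p q).trans (by gcongr; simpa using h1)
  · exact (hA₂ ⟨ε, hεm⟩ x).trans (by simpa using h2)
  · exact (hA₃ ⟨ε, hεm⟩ x x').trans (by gcongr; simpa using h3)
  · have h5 := hA₄ ⟨ε, hεm⟩ x
    rw [slowIterate_eq, h.g_fastSolve, norm_sub_rev]
    have := hεm.1.le
    exact h5.trans (by gcongr)

end SlowFastAssumptions

/-! ### Scalar differential inequalities -/

theorem nonpos_of_hasDerivWithinAt_le_mul {T c : ℝ} {u u' : ℝ → ℝ}
    (hu : ∀ t ∈ Icc 0 T, HasDerivWithinAt u (u' t) (Icc 0 T) t)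
    (hle : ∀ t ∈ Icc 0 T, u' t ≤ c * u t) (h0 : u 0 ≤ 0) : ∀ t ∈ Icc 0 T, u t ≤ 0 := by
  intro t ht
  have hexp : ∀ s, HasDerivAt (fun s => Real.exp (-c * s)) (Real.exp (-c * s) * (-c)) s :=
    fun s => by simpa using ((hasDerivAt_id s).const_mul (-c)).exp
  have hv : ∀ s ∈ Icc 0 T, HasDerivWithinAt (fun s => u s * Real.exp (-c * s))
      (u' s * Real.exp (-c * s) + u s * (Real.exp (-c * s) * (-c))) (Icc 0 T) s :=
    fun s hs => (hu s hs).mul (hexp s).hasDerivWithinAt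
  have hanti : AntitoneOn (fun s => u s * Real.exp (-c * s)) (Icc 0 T) := by
    refine antitoneOn_of_hasDerivWithinAt_nonpos (convex_Icc 0 T)
      (fun s hs => (hv s hs).continuousWithinAt)
      (fun s hs => (hv s (interior_subset hs)).mono interior_subset) fun s hs => ?_
    have := mul_le_mul_of_nonneg_right (hle s (interior_subset hs)) (Real.exp_pos (-c * s)).le
    linarith
  have h := hanti (left_mem_Icc.2 (ht.1.trans ht.2)) ht ht.1
  simp only [mul_zero, Real.exp_zero, mul_one] at h
  exact nonpos_of_mul_nonpos_left (h.trans h0) (Real.exp_pos _)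

theorem hasDerivAt_exp_mul (c s : ℝ) :
    HasDerivAt (fun s => Real.exp (c * s)) (c * Real.exp (c * s)) s := by
  simpa [mul_comm] using ((hasDerivAt_id s).const_mul c).exp

/-- Comparison for `E' ≤ D E + D Z`, `Z' ≤ (D - 3b/2) Z + D q / η`, where `b = β / η`. -/
theorem coupled_gronwall {β D η q T : ℝ} {E Z E' Z' : ℝ → ℝ} (hβ : 0 < β) (hD : 0 < D)
    (hη : 0 < η) (hq : 0 ≤ q) (hE0 : ∀ t, 0 ≤ E t) (hZ0 : ∀ t, 0 ≤ Z t)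
    (hE : ∀ t ∈ Icc 0 T, HasDerivWithinAt E (E' t) (Icc 0 T) t)
    (hZ : ∀ t ∈ Icc 0 T, HasDerivWithinAt Z (Z' t) (Icc 0 T) t)
    (hE' : ∀ t ∈ Icc 0 T, E' t ≤ D * E t + D * Z t)
    (hZ' : ∀ t ∈ Icc 0 T, Z' t ≤ (D - 3 / 2 * (β / η)) * Z t + D * (q / η)) :
    ∀ t ∈ Icc 0 T, E t ≤ Real.exp ((4 * D + 4 * D ^ 2 / β) * t) * E 0
      + q * (Real.exp ((4 * D + 4 * D ^ 2 / β) * t) - 1)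
      + (4 * D + 4 * D ^ 2 / β) *
        ((Real.exp ((4 * D + 4 * D ^ 2 / β) * t) - Real.exp (-(β / η) * t)) /
          (β / η + (4 * D + 4 * D ^ 2 / β))) * Z 0 := by
  set C := 4 * D + 4 * D ^ 2 / β with hC
  set b := β / η with hb
  have hbpos : 0 < b := div_pos hβ hη
  have hD2 : 0 < D ^ 2 / β := by positivity
  have hC4 : 4 * D ≤ C := by rw [hC]; linarith [mul_div_assoc 4 (D ^ 2) β]
  have hC4' : 4 * (D ^ 2 / β) ≤ C := by rw [hC]; linarith [mul_div_assoc 4 (D ^ 2) β]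
  have hCpos : 0 < C := by linarith
  have hbC : 0 < b + C := by linarith
  have hqη : q / η = b * (q / β) := by rw [hb]; field_simp
  -- `P` is the claimed bound. By `hkey`, `D Z ≤ P' - (C/2) P`, whence `(E - P)' ≤ (C/2) (E - P)`.
  set P : ℝ → ℝ := fun t => Real.exp (C * t) * E 0 + q * (Real.exp (C * t) - 1)
      + C * ((Real.exp (C * t) - Real.exp (-b * t)) / (b + C)) * Z 0 with hP
  have hPd : ∀ t, HasDerivAt P (C * P t + C * Real.exp (-b * t) * Z 0 + C * q) t := by
    intro t
    have h := (((hasDerivAt_exp_mul C t).mul_const (E 0)).add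
      (((hasDerivAt_exp_mul C t).sub_const 1).const_mul q)).add
      (((((hasDerivAt_exp_mul C t).sub (hasDerivAt_exp_mul (-b) t)).div_const
        (b + C)).const_mul C).mul_const (Z 0))
    refine h.congr_deriv ?_
    simp only [hP]
    field_simp
    ring
  have hkey : ∀ t ∈ Icc 0 T, D * Z t ≤ C / 2 * P t + C * Real.exp (-b * t) * Z 0 + C * q := by
    intro t ht
    have hCt : 1 ≤ Real.exp (C * t) := Real.one_le_exp (mul_nonneg hCpos.le ht.1)
    have hbt : Real.exp (-b * t) ≤ Real.exp (C * t) :=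
      Real.exp_le_exp.2 (mul_le_mul_of_nonneg_right (by linarith) ht.1)
    have hZ00 := hZ0 0
    have h1 : 0 ≤ Real.exp (C * t) * E 0 := mul_nonneg (Real.exp_pos _).le (hE0 0)
    have h2 : 0 ≤ q * (Real.exp (C * t) - 1) := mul_nonneg hq (by linarith)
    have h3 : 0 ≤ C * ((Real.exp (C * t) - Real.exp (-b * t)) / (b + C)) * Z 0 :=
      mul_nonneg (mul_nonneg hCpos.le (div_nonneg (by linarith) hbC.le)) hZ00
    -- For `b ≥ 2D` the net rate is at most `-b`, so `Z` stays below `exp(-bt) Z(0) + D q/β`. For `b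
    -- < 2D` the damping is discarded; the growth `exp(Dt)` is absorbed by `(C/2) P`, because `b ≤
    -- C` makes `C/(b + C)` at least `1/2`.
    rcases le_or_gt (2 * D) b with hcase | hcase
    · have hu := nonpos_of_hasDerivWithinAt_le_mul (T := T) (c := -b)
        (u := fun t => Z t - (Real.exp (-b * t) * Z 0 + D * (q / β)))
        (fun s hs => (hZ s hs).sub
          (((hasDerivAt_exp_mul (-b) s).mul_const (Z 0)).add_const _).hasDerivWithinAt)
        (fun s hs => by
          have := hZ' s hs
          rw [hqη] at this
          have h4 : (D - 3 / 2 * b) * Z s ≤ -b * Z s :=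
            mul_le_mul_of_nonneg_right (by linarith) (hZ0 s)
          linarith) (by
          have : 0 ≤ D * (q / β) := by positivity
          simp only [mul_zero, Real.exp_zero, one_mul]
          linarith) t ht
      have h5 : D * Z t ≤ D * (Real.exp (-b * t) * Z 0) + D ^ 2 / β * q := by
        have := mul_le_mul_of_nonneg_left (sub_nonpos.1 hu) hD.le
        calc _ ≤ _ := this
          _ = _ := by ring
      have h6 : 0 ≤ C / 2 * P t := mul_nonneg (by linarith) (by simp only [hP]; linarith)
      have h7 : D * (Real.exp (-b * t) * Z 0) ≤ C * (Real.exp (-b * t) * Z 0) :=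
        mul_le_mul_of_nonneg_right (by linarith) (mul_nonneg (Real.exp_pos _).le hZ00)
      have h8 : D ^ 2 / β * q ≤ C * q := mul_le_mul_of_nonneg_right (by linarith) hq
      linarith
    · have hu := nonpos_of_hasDerivWithinAt_le_mul (T := T) (c := D)
        (u := fun t => Z t - (Real.exp (D * t) * Z 0 +
          (Real.exp (D * t) - 1) * (2 * D * (q / β))))
        (fun s hs => (hZ s hs).sub
          (((hasDerivAt_exp_mul D s).mul_const (Z 0)).add
            (((hasDerivAt_exp_mul D s).sub_const 1).mul_const _)).hasDerivWithinAt)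
        (fun s hs => by
          have := hZ' s hs
          rw [hqη] at this
          have h4 : (D - 3 / 2 * b) * Z s ≤ D * Z s :=
            mul_le_mul_of_nonneg_right (by linarith) (hZ0 s)
          have h5 : D * (b * (q / β)) ≤ D * (2 * D * (q / β)) := by gcongr
          linarith) (by simp) t ht
      have hDt : Real.exp (D * t) ≤ Real.exp (C * t) :=
        Real.exp_le_exp.2 (mul_le_mul_of_nonneg_right (by linarith) ht.1)
      have h4 : (Real.exp (C * t) - Real.exp (-b * t)) / 2 ≤
          C * ((Real.exp (C * t) - Real.exp (-b * t)) / (b + C)) := by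
        rw [mul_div_assoc', div_le_div_iff₀ two_pos hbC]
        have := mul_le_mul_of_nonneg_left (show b + C ≤ C * 2 by linarith) (sub_nonneg.2 hbt)
        linarith
      have h5 := mul_le_mul_of_nonneg_right h4 hZ00
      have h6 : C / 2 * (q * (Real.exp (C * t) - 1)
          + (Real.exp (C * t) - Real.exp (-b * t)) / 2 * Z 0) ≤ C / 2 * P t :=
        mul_le_mul_of_nonneg_left (by simp only [hP]; linarith) (by linarith)
      have h7 : D * Z t ≤ D * Real.exp (C * t) * Z 0 + 2 * (D ^ 2 / β) * Real.exp (C * t) * q := by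
        have h8 : Z t ≤ Real.exp (C * t) * Z 0 + Real.exp (C * t) * (2 * D * (q / β)) := by
          refine (sub_nonpos.1 hu).trans ?_
          gcongr
          linarith
        calc _ ≤ _ := mul_le_mul_of_nonneg_left h8 hD.le
          _ = _ := by ring
      have h8 : D * Real.exp (C * t) * Z 0 ≤ C / 4 * Real.exp (C * t) * Z 0 := by
        gcongr; linarith
      have h9 : 2 * (D ^ 2 / β) * Real.exp (C * t) * q ≤ C / 2 * Real.exp (C * t) * q := by
        gcongr; linarith
      have h10 : 0 ≤ C * (Real.exp (-b * t) * Z 0) := by positivity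
      have h11 : 0 ≤ C * q := by positivity
      linarith
  intro t ht
  have := nonpos_of_hasDerivWithinAt_le_mul (T := T) (c := C / 2) (u := fun t => E t - P t)
    (fun s hs => (hE s hs).sub (hPd s).hasDerivWithinAt)
    (fun s hs => by
      have h1 := hE' s hs
      have h2 := hkey s hs
      have h3 : D * E s ≤ C / 2 * E s := mul_le_mul_of_nonneg_right (by linarith) (hE0 s)
      linarith) (by simp [hP]) t ht
  exact sub_nonpos.1 this

/-! ### Energy inequalities for the slow and fast errors -/

section ErrorDynamics

variable {V W : Type*} [NormedAddCommGroup V] [InnerProductSpace ℝ V]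

theorem two_mul_inner_le (u v : V) {r : ℝ} (h : ‖v‖ ≤ r) :
    2 * inner ℝ u v ≤ 2 * (‖u‖ * r) := by
  have := (real_inner_le_norm u v).trans (mul_le_mul_of_nonneg_left h (norm_nonneg u))
  linarith

theorem two_mul_inner_sub_le {W : Type*} [NormedAddCommGroup W] {f : V × W → V}
    {Γ : V → W} {A : ℝ} (hA : 0 < A)
    (hf : ∀ p q, ‖f p - f q‖ ≤ A * ‖p - q‖) (hΓ : ∀ x x', ‖Γ x - Γ x'‖ ≤ A * ‖x - x'‖)
    (x X : V) (y : W) :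
    2 * inner ℝ (x - X) (f (x, y) - f (X, Γ X)) ≤
      (3 * A + 2 * A ^ 2) * ‖x - X‖ ^ 2 + A * ‖y - Γ x‖ ^ 2 := by
  have h1 : ‖f (x, y) - f (X, Γ X)‖ ≤ A * (‖x - X‖ + (‖y - Γ x‖ + A * ‖x - X‖)) := by
    refine (hf _ _).trans (mul_le_mul_of_nonneg_left ?_ hA.le)
    have h2 : ‖y - Γ X‖ ≤ ‖y - Γ x‖ + A * ‖x - X‖ := by
      calc ‖y - Γ X‖ = ‖(y - Γ x) + (Γ x - Γ X)‖ := by simp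
        _ ≤ _ := (norm_add_le _ _).trans (add_le_add le_rfl (hΓ _ _))
    refine max_le ?_ ?_
    · exact le_add_of_nonneg_right (by positivity)
    · exact h2.trans (le_add_of_nonneg_left (norm_nonneg _))
  have h3 := two_mul_inner_le (x - X) _ h1
  have h4 := mul_nonneg hA.le (sq_nonneg (‖x - X‖ - ‖y - Γ x‖))
  nlinarith

/-- Dissipation contributes `-2β/ε`; Young's inequality for the defect gives back `β/(2ε)`, leaving
the rate `-3β/(2ε)`. The remaining term is controlled by Lipschitz bounds free of `ε`. -/
theorem two_mul_inner_fast_le {W : Type*} [NormedAddCommGroup W] [InnerProductSpace ℝ W]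
    {f : V × W → V} {g : V × W → W} {Γ : V → W} {Γ' : V →L[ℝ] W}
    {A β ε δ : ℝ} (hA : 0 < A) (hβ : 0 < β) (hε : 0 < ε)
    (hf : ∀ p q, ‖f p - f q‖ ≤ A * ‖p - q‖) {x : V} {y : W}
    (hdiss : inner ℝ (y - Γ x) (g (x, y) - g (x, Γ x)) ≤ -β * ‖y - Γ x‖ ^ 2)
    (hΓ' : ‖Γ'‖ ≤ A) (hres : ‖g (x, Γ x) - ε • Γ' (f (x, Γ x))‖ ≤ A * δ) :
    2 * inner ℝ (y - Γ x) (ε⁻¹ • g (x, y) - Γ' (f (x, y))) ≤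
      (2 * A ^ 2 - 3 / 2 * (β / ε)) * ‖y - Γ x‖ ^ 2 + 2 * A ^ 2 / β * (δ ^ 2 / ε) := by
  set z := y - Γ x with hz
  have hsplit : ε⁻¹ • g (x, y) - Γ' (f (x, y)) = ε⁻¹ • (g (x, y) - g (x, Γ x))
      + ε⁻¹ • (g (x, Γ x) - ε • Γ' (f (x, Γ x))) + Γ' (f (x, Γ x) - f (x, y)) := by
    simp only [smul_sub, map_sub, smul_smul, inv_mul_cancel₀ hε.ne', one_smul]
    abel
  have h1 : 2 * inner ℝ z (ε⁻¹ • (g (x, y) - g (x, Γ x))) ≤ -2 * (β / ε) * ‖z‖ ^ 2 := by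
    rw [inner_smul_right]
    have := mul_le_mul_of_nonneg_left hdiss (inv_pos.2 hε).le
    calc _ ≤ 2 * (ε⁻¹ * (-β * ‖z‖ ^ 2)) := by linarith
      _ = _ := by ring
  have h2 : 2 * inner ℝ z (ε⁻¹ • (g (x, Γ x) - ε • Γ' (f (x, Γ x)))) ≤
      1 / 2 * (β / ε) * ‖z‖ ^ 2 + 2 * A ^ 2 / β * (δ ^ 2 / ε) := by
    rw [inner_smul_right]
    have h3 := two_mul_inner_le z _ hres
    have h4 := mul_le_mul_of_nonneg_left h3 (inv_pos.2 hε).le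
    -- Young's inequality written as a completed square.
    have h5 : 0 ≤ (β * ε)⁻¹ * (1 / 2) * (β * ‖z‖ - 2 * A * δ) ^ 2 := by positivity
    have h6 : (β * ε)⁻¹ * (1 / 2) * (β * ‖z‖ - 2 * A * δ) ^ 2 =
        1 / 2 * (β / ε) * ‖z‖ ^ 2 + 2 * A ^ 2 / β * (δ ^ 2 / ε)
          - ε⁻¹ * (2 * (‖z‖ * (A * δ))) := by
      field_simp
      ring
    linarith
  have h3 : 2 * inner ℝ z (Γ' (f (x, Γ x) - f (x, y))) ≤ 2 * A ^ 2 * ‖z‖ ^ 2 := by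
    have h4 : ‖Γ' (f (x, Γ x) - f (x, y))‖ ≤ A * (A * ‖z‖) := by
      refine (Γ'.le_opNorm _).trans (mul_le_mul hΓ' ?_ (norm_nonneg _) hA.le)
      refine (hf _ _).trans_eq ?_
      simp [Prod.norm_def, hz, norm_sub_rev]
    refine (two_mul_inner_le z _ h4).trans_eq (by ring)
  rw [hsplit, inner_add_right, inner_add_right]
  linarith

end ErrorDynamics

/-! ### The error estimate and its finite-time consequence -/

theorem SlowFastAssumptions.exists_error_bound {nx ny K k : ℕ} {β ε₀ : ℝ}
    {f : EuclideanSpace ℝ (Fin nx) × EuclideanSpace ℝ (Fin ny) → EuclideanSpace ℝ (Fin nx)}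
    {g : EuclideanSpace ℝ (Fin nx) × EuclideanSpace ℝ (Fin ny) → EuclideanSpace ℝ (Fin ny)}
    (h : SlowFastAssumptions f g β K) (hk : k ≤ K)
    (hΓ : ∀ ε ∈ Ioc 0 ε₀, Differentiable ℝ (slowIterate f g ε k)) :
    ∃ C : ℝ, 0 < C ∧ ∀ ε ∈ Ioc 0 ε₀, ∀ T : ℝ, ∀ x y X,
      IsFullSolution f g ε T x y → IsReducedSolution f (slowIterate f g ε k) T X →
      ∀ t ∈ Icc 0 T, ‖x t - X t‖ ^ 2 ≤ Real.exp (C * t) * ‖x 0 - X 0‖ ^ 2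
          + ε ^ (2 * k + 2) * (Real.exp (C * t) - 1)
          + C * ((Real.exp (C * t) - Real.exp (-(β / ε) * t)) / (β / ε + C))
            * ‖y 0 - slowIterate f g ε k (x 0)‖ ^ 2 := by
  obtain ⟨A, hA, hf, hbounds⟩ := h.exists_slowIterate_bounds (ε₀ := ε₀) hk
  have hβ := h.beta_pos
  -- One constant dominating every coefficient of the two energy inequalities.
  set D := 3 * A + 2 * A ^ 2 + 2 * A ^ 2 / β with hD
  have hDβ : 2 * A ^ 2 / β ≤ D := by rw [hD]; linarith [sq_nonneg A]
  have hβA : 0 < 2 * A ^ 2 / β := by positivity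
  refine ⟨4 * D + 4 * D ^ 2 / β, by positivity, fun ε hε T x y X hxy hX => ?_⟩
  obtain ⟨hDΓ, hLΓ, hres⟩ := hbounds ε hε
  have hε0 : 0 < ε := hε.1
  set Γ := slowIterate f g ε k with hΓdef
  refine coupled_gronwall (E := fun t => ‖x t - X t‖ ^ 2) (Z := fun t => ‖y t - Γ (x t)‖ ^ 2)
    hβ (by positivity) hε0 (by positivity) (fun t => sq_nonneg _) (fun t => sq_nonneg _)
    (fun t ht => ((hxy t ht).1.sub (hX t ht)).norm_sq)
    (fun t ht => ((hxy t ht).2.sub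
      (((hΓ ε hε) (x t)).hasFDerivAt.comp_hasDerivWithinAt t (hxy t ht).1)).norm_sq)
    (fun t ht => ?_) (fun t ht => ?_)
  · refine (two_mul_inner_sub_le hA hf hLΓ (x t) (X t) (y t)).trans ?_
    gcongr
    · linarith
    · rw [hD]; linarith [sq_nonneg A]
  · refine (two_mul_inner_fast_le hA hβ hε0 hf
      (h.dissipative (x t) (y t) (Γ (x t))) (hDΓ (x t)) (hres (x t))).trans ?_
    rw [← pow_mul, show (k + 1) * 2 = 2 * k + 2 by ring]
    gcongr
    rw [hD]; linarith

theorem mainTheorem2 (nx ny K k : ℕ) (hk : k ≤ K)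
    (f : EuclideanSpace ℝ (Fin nx) × EuclideanSpace ℝ (Fin ny) → EuclideanSpace ℝ (Fin nx))
    (g : EuclideanSpace ℝ (Fin nx) × EuclideanSpace ℝ (Fin ny) → EuclideanSpace ℝ (Fin ny))
    (β ε₀ : ℝ) (hε₀ : 0 < ε₀) (hfg : SlowFastAssumptions f g β K) :
    -- the iterates up to order `k` are well defined and continuously differentiable
    (∀ ε ∈ Ioc 0 ε₀,
      (∀ x y, g (x, y) = 0 ↔ y = slowIterate f g ε 0 x) ∧
      (∀ j < k, ∀ x y, g (x, y) = iterRhs f ε (slowIterate f g ε j) x ↔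
        y = slowIterate f g ε (j + 1) x) ∧
      (∀ j ≤ k, ContDiff ℝ 1 (slowIterate f g ε j))) ∧
    -- the error bound, with a constant independent of `ε`, of time and of the solutions
    (∃ C : ℝ, 0 < C ∧ ∀ ε ∈ Ioc 0 ε₀, ∀ T : ℝ, ∀ x y X,
      IsFullSolution f g ε T x y → IsReducedSolution f (slowIterate f g ε k) T X →
      ∀ t ∈ Icc 0 T,
        ‖x t - X t‖ ^ 2 ≤ Real.exp (C * t) * ‖x 0 - X 0‖ ^ 2
          + ε ^ (2 * k + 2) * (Real.exp (C * t) - 1)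
          + C * ((Real.exp (C * t) - Real.exp (-(β / ε) * t)) / (β / ε + C))
            * ‖y 0 - slowIterate f g ε k (x 0)‖ ^ 2 ∧
        C * ((Real.exp (C * t) - Real.exp (-(β / ε) * t)) / (β / ε + C))
            * ‖y 0 - slowIterate f g ε k (x 0)‖ ^ 2
          ≤ C / β * Real.exp (C * t) * (ε * ‖y 0 - slowIterate f g ε k (x 0)‖ ^ 2)) ∧
    -- accuracy of order `ε ^ (k + 1)` over finite times
    (∀ T : ℝ, 0 < T → ∀ R : ℝ, 0 ≤ R → ∃ M : ℝ, 0 < M ∧ ∀ ε ∈ Ioc 0 ε₀, ∀ x y X,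
      IsFullSolution f g ε T x y → IsReducedSolution f (slowIterate f g ε k) T X →
      ‖x 0 - X 0‖ ≤ R * ε ^ (k + 1) →
      ‖y 0 - slowIterate f g ε k (x 0)‖ ^ 2 ≤ R * ε ^ (2 * k + 1) →
      ∀ t ∈ Icc 0 T, ‖x t - X t‖ ≤ M * ε ^ (k + 1)) := by
  have hβ := hfg.beta_pos
  have hsmooth : ∀ ε ∈ Ioc 0 ε₀, ∀ j ≤ k, ContDiff ℝ 1 (slowIterate f g ε j) := by
    intro ε hε j hj
    have := (hfg.uniformDerivBound_slowIterate (fun i : Ioc 0 ε₀ => (i : ℝ))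
      (fun i => i.2.1.le) (fun i => i.2.2) j (hj.trans hk)).contDiff ⟨ε, hε⟩
    exact this.of_le (by exact_mod_cast (by omega : 1 ≤ K + 1 - j))
  obtain ⟨C, hC, hbound⟩ := hfg.exists_error_bound hk
    (fun ε hε => (hsmooth ε hε k le_rfl).differentiable one_ne_zero)
  have hfactor : ∀ ε : ℝ, 0 < ε → ∀ t Z : ℝ, 0 ≤ Z →
      C * ((Real.exp (C * t) - Real.exp (-(β / ε) * t)) / (β / ε + C)) * Z ≤
        C / β * Real.exp (C * t) * (ε * Z) := by
    intro ε hε t Z hZ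
    have h1 : (Real.exp (C * t) - Real.exp (-(β / ε) * t)) / (β / ε + C) ≤
        Real.exp (C * t) / (β / ε) := by
      gcongr
      · linarith [Real.exp_pos (-(β / ε) * t)]
      · linarith
    calc _ ≤ C * (Real.exp (C * t) / (β / ε)) * Z := by gcongr
      _ = _ := by field_simp
  refine ⟨fun ε hε => ⟨fun x y => hfg.g_eq_iff x y 0, fun j _ x y => hfg.g_eq_iff x y _,
    hsmooth ε hε⟩, ⟨C, hC, fun ε hε T x y X hxy hX t ht =>
      ⟨hbound ε hε T x y X hxy hX t ht, hfactor ε hε.1 t _ (sq_nonneg _)⟩⟩, ?_⟩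
  intro T hT R hR
  -- The three summands match the three terms of the bound, each of size `ε^(2k+2)`. Since `M ≥ 1`,
  -- `M ≤ M²`, so no square root of the constant is needed.
  set M := Real.exp (C * T) * (R ^ 2 + 1 + C / β * R) with hM
  have hM1 : 1 ≤ M := by
    have h1 : 1 ≤ Real.exp (C * T) := Real.one_le_exp (by positivity)
    have h2 : 0 ≤ C / β * R := by positivity
    exact one_le_mul_of_one_le_of_one_le h1 (by linarith [sq_nonneg R])
  refine ⟨M, by linarith, fun ε hε x y X hxy hX hx0 hz0 t ht => ?_⟩
  have hε0 : 0 < ε := hε.1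
  have h1 := hbound ε hε T x y X hxy hX t ht
  have h2 := hfactor ε hε0 t _ (sq_nonneg ‖y 0 - slowIterate f g ε k (x 0)‖)
  have hexp : Real.exp (C * t) ≤ Real.exp (C * T) := by gcongr; exact ht.2
  have h3 : Real.exp (C * t) * ‖x 0 - X 0‖ ^ 2 ≤
      Real.exp (C * T) * (R * ε ^ (k + 1)) ^ 2 := by gcongr
  have h4 : ε ^ (2 * k + 2) * (Real.exp (C * t) - 1) ≤ ε ^ (2 * k + 2) * Real.exp (C * T) := by
    gcongr
    linarith
  have h5 : C / β * Real.exp (C * t) * (ε * ‖y 0 - slowIterate f g ε k (x 0)‖ ^ 2) ≤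
      C / β * Real.exp (C * T) * (ε * (R * ε ^ (2 * k + 1))) := by gcongr
  refine le_of_sq_le_sq ?_ (by positivity)
  calc ‖x t - X t‖ ^ 2 ≤ M * ε ^ (2 * k + 2) := by
        rw [hM]
        refine (h1.trans (add_le_add (add_le_add h3 h4) (h2.trans h5))).trans_eq ?_
        ring
    _ ≤ M ^ 2 * ε ^ (2 * k + 2) := by
        gcongr
        exact le_self_pow₀ hM1 two_ne_zero
    _ = _ := by ring
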